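/- Let $\mathbb H=\mathbb T\times\mathbb R\times\mathbb R$ be the (reduced) Heisenberg group with multiplication $(z_1,y_1,x_1)(z_2,y_2,x_2)=(z_1z_2e^{-2\pi i x_1y_2},\,y_1+y_2,\,x_1+x_2)$ and centre $Z=\{(z,0,0):z\in\mathbb T\}$, equipped with Lebesgue measure on $\mathbb T\times\mathbb R\times\mathbb R$ ($\mathbb T$ having total mass $1$). For $h\in\mathbb H$ let $L_h$ be the left translation $(L_hF)(g)=F(h^{-1}g)$ on $L^2(\mathbb H)$. Let $A$ be a bounded operator on $L^2(\mathbb H)$ with a bounded inverse, such that $AL_h=L_hA$ for all $h\in\mathbb H$. Let $F\in L^2(\mathbb H)$ be Schwartz in the $(y,x)$-variable, i.e. for almost every $z\in\mathbb T$ the function $(y,x)\mapsto F(z,y,x)$ agrees almost everywhere with a Schwartz function on $\mathbb R^2$, and supported on a half-line in the $x$-variable, i.e. there is $a\in\mathbb R$ such that $F$ vanishes almost everywhere outside $\mathbb T\times\mathbb R\times[a,\infty)$, or almost everywhere outside $\mathbb T\times\mathbb R\times(-\infty,a]$. Suppose that $AF\neq0$ (equivalently, $F\ne 0$). Then the Heisenberg-Translate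 conjecture holds for $AF$: for every finite set $\mathcal F\subset\mathbb H$ such that the cosets $hZ$, $h\in\mathcal F$, are distinct, the vectors $L_h(AF)$, $h\in\mathcal F$, are linearly independent in $L^2(\mathbb H)$. -/

import Mathlib

open MeasureTheory

noncomputable section

/-- The (reduced) Heisenberg group, with underlying set `𝕋 × ℝ × ℝ`;
`(z, y, x)` stands for the unitary operator `z M_y T_x` on `L²(ℝ)`. -/
@[ext]
structure Heisenberg : Type where
  z : Circle
  y : ℝ
  x : ℝ

namespace Heisenberg

/-- `(z₁, y₁, x₁) (z₂, y₂, x₂) = (z₁ z₂ e^{-2πi x₁ y₂}, y₁ + y₂, x₁ + x₂)`. -/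
instance : Mul Heisenberg :=
  ⟨fun g h => ⟨g.z * h.z * Circle.exp (-(2 * Real.pi * (g.x * h.y))), g.y + h.y, g.x + h.x⟩⟩

instance : One Heisenberg := ⟨⟨1, 0, 0⟩⟩

instance : Inv Heisenberg :=
  ⟨fun g => ⟨g.z⁻¹ * Circle.exp (-(2 * Real.pi * (g.x * g.y))), -g.y, -g.x⟩⟩

theorem mul_def (g h : Heisenberg) :
    g * h = ⟨g.z * h.z * Circle.exp (-(2 * Real.pi * (g.x * h.y))), g.y + h.y, g.x + h.x⟩ := rfl

theorem one_def : (1 : Heisenberg) = ⟨1, 0, 0⟩ := rfl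

theorem inv_def (g : Heisenberg) :
    g⁻¹ = ⟨g.z⁻¹ * Circle.exp (-(2 * Real.pi * (g.x * g.y))), -g.y, -g.x⟩ := rfl

instance : Group Heisenberg :=
  Group.ofLeftAxioms
    (by
      intro a b c
      ext1
      · have h : -(2 * Real.pi * (a.x * b.y)) + -(2 * Real.pi * ((a.x + b.x) * c.y)) =
            -(2 * Real.pi * (b.x * c.y)) + -(2 * Real.pi * (a.x * (b.y + c.y))) := by ring
        have h' := congrArg Circle.exp h
        rw [Circle.exp_add, Circle.exp_add] at h'
        simp only [mul_def]
        calc _ = a.z * b.z * c.z * (Circle.exp (-(2 * Real.pi * (a.x * b.y))) *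
              Circle.exp (-(2 * Real.pi * ((a.x + b.x) * c.y)))) := by
              simp only [mul_assoc, mul_left_comm, mul_comm]
          _ = _ := by rw [h']; simp only [mul_assoc]
      · exact add_assoc _ _ _
      · exact add_assoc _ _ _)
    (by intro a; ext1 <;> simp [mul_def, one_def])
    (by
      intro a
      ext1
      · have h : -(2 * Real.pi * (a.x * a.y)) + -(2 * Real.pi * (-a.x * a.y)) = 0 := by ring
        have h' := congrArg Circle.exp h
        rw [Circle.exp_add, Circle.exp_zero] at h'
        simp only [mul_def, one_def, inv_def]
        calc _ = (a.z⁻¹ * a.z) * (Circle.exp (-(2 * Real.pi * (a.x * a.y))) *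
              Circle.exp (-(2 * Real.pi * (-a.x * a.y)))) := by
              simp only [mul_assoc, mul_left_comm, mul_comm]
          _ = _ := by rw [h']; simp
      · simp [mul_def, one_def, inv_def]
      · simp [mul_def, one_def, inv_def])

/-- The centre `Z = {(z, 0, 0) : z ∈ 𝕋}` of the Heisenberg group. -/
def Z : Subgroup Heisenberg where
  carrier := {h | h.y = 0 ∧ h.x = 0}
  one_mem' := ⟨rfl, rfl⟩
  mul_mem' := by
    rintro a b ⟨ha, ha'⟩ ⟨hb, hb'⟩
    simp [mul_def, ha, ha', hb, hb']
  inv_mem' := by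
    rintro a ⟨ha, ha'⟩
    simp [inv_def, ha, ha']

/-- Coordinates on the Heisenberg group. -/
def equivProd : Heisenberg ≃ Circle × ℝ × ℝ where
  toFun h := (h.z, h.y, h.x)
  invFun p := ⟨p.1, p.2.1, p.2.2⟩
  left_inv _ := rfl
  right_inv _ := rfl

/-- The circle carries its Borel `σ`-algebra. -/
instance : MeasurableSpace Circle := borel Circle

instance : BorelSpace Circle := ⟨rfl⟩

/-- The Borel `σ`-algebra of `𝕋 × ℝ × ℝ`, transported to the Heisenberg group. -/
instance : MeasurableSpace Heisenberg := MeasurableSpace.comap equivProd inferInstance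

theorem measurable_equivProd : Measurable equivProd := comap_measurable _

theorem measurable_equivProd_symm : Measurable equivProd.symm := by
  rintro s ⟨t, ht, rfl⟩
  simpa [Set.preimage_preimage] using ht

/-- Lebesgue measure on the circle, normalised to have total mass one
(the invariant probability measure). -/
def circleMeasure : Measure Circle := Measure.haarMeasure ⊤

instance : IsProbabilityMeasure circleMeasure :=
  ⟨by simpa [circleMeasure] using
    Measure.haarMeasure_self (K₀ := (⊤ : TopologicalSpace.PositiveCompacts Circle))⟩

instance : circleMeasure.IsMulLeftInvariant := by
  unfold circleMeasure; infer_instance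

/-- Lebesgue measure on `𝕋 × ℝ × ℝ`, as a measure on the Heisenberg group. -/
instance : MeasureSpace Heisenberg :=
  ⟨(circleMeasure.prod (volume : Measure (ℝ × ℝ))).map equivProd.symm⟩

theorem volume_def : (volume : Measure Heisenberg) =
    (circleMeasure.prod (volume : Measure (ℝ × ℝ))).map equivProd.symm := rfl

theorem measurePreserving_equivProd : MeasurePreserving equivProd
    (volume : Measure Heisenberg) (circleMeasure.prod (volume : Measure (ℝ × ℝ))) := by
  refine ⟨measurable_equivProd, ?_⟩
  rw [volume_def, Measure.map_map measurable_equivProd measurable_equivProd_symm]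
  simp

theorem measurePreserving_equivProd_symm : MeasurePreserving equivProd.symm
    (circleMeasure.prod (volume : Measure (ℝ × ℝ))) (volume : Measure Heisenberg) :=
  ⟨measurable_equivProd_symm, rfl⟩

/-- Left translations preserve the measure. -/
theorem measurePreserving_mul_left (g : Heisenberg) :
    MeasurePreserving (fun h : Heisenberg => g * h) volume volume := by
  have hbase : MeasurePreserving (fun p : ℝ × ℝ => (g.y + p.1, g.x + p.2)) volume volume :=
    (measurePreserving_add_left volume g.y).prod (measurePreserving_add_left volume g.x)
  have hskew := hbase.skew_product (μc := circleMeasure) (μd := circleMeasure)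
    (g := fun p w => g.z * w * Circle.exp (-(2 * Real.pi * (g.x * p.1))))
    (by
      apply Continuous.measurable
      simp only [Function.uncurry_def]
      fun_prop)
    (Filter.Eventually.of_forall fun p => by
      have : (fun w : Circle => g.z * w * Circle.exp (-(2 * Real.pi * (g.x * p.1)))) =
          fun w => (g.z * Circle.exp (-(2 * Real.pi * (g.x * p.1)))) * w := by
        funext w; exact mul_right_comm _ _ _
      rw [this]
      exact map_mul_left_eq_self _ _)
  exact measurePreserving_equivProd_symm.comp
    ((Measure.measurePreserving_swap.comp (hskew.comp Measure.measurePreserving_swap)).comp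
      measurePreserving_equivProd)

/-- The Hilbert space `L²(ℍ)`. -/
abbrev L2 : Type := Lp ℂ 2 (volume : Measure Heisenberg)

/-- The left translation `L_k` of `L²(ℍ)`, `(L_k F)(h) = F(k⁻¹ h)`. -/
def leftTranslation (k : Heisenberg) : L2 →L[ℂ] L2 :=
  (Lp.compMeasurePreservingₗᵢ ℂ (fun h : Heisenberg => k⁻¹ * h)
    (measurePreserving_mul_left k⁻¹)).toContinuousLinearMap

/-- `𝒞(L)`: the bounded operators on `L²(ℍ)` that commute with all left translations. -/
def leftCommutant : Set (L2 →L[ℂ] L2) :=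
  {A | ∀ h : Heisenberg, A * leftTranslation h = leftTranslation h * A}

/-- The Heisenberg-Translate conjecture holds for `F`: for each finite set `S` of elements of
`ℍ` whose cosets `h Z` are distinct, the translates `L_h F`, `h ∈ S`, are linearly independent. -/
def TranslatesIndependent (F : L2) : Prop :=
  ∀ S : Finset Heisenberg,
    Set.InjOn (fun h : Heisenberg => (h : Heisenberg ⧸ Z)) (S : Set Heisenberg) →
      LinearIndependent ℂ (fun h : S => leftTranslation (h : Heisenberg) F)

/-- `F` is Schwartz in the `(y, x)`-variable: for almost every `z`, the function
`F(z, ·, ·)` is (almost everywhere equal to) a Schwartz function on `ℝ²`. -/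
def IsSchwartzYX (F : L2) : Prop :=
  ∀ᵐ z ∂circleMeasure, ∃ φ : SchwartzMap (ℝ × ℝ) ℂ, ∀ᵐ p : ℝ × ℝ, F ⟨z, p.1, p.2⟩ = φ p

/-- `F` is supported on a half-line in the `x`-variable: it vanishes (almost everywhere)
outside `𝕋 × ℝ × [a, ∞)` or outside `𝕋 × ℝ × (-∞, a]` for some real `a`. -/
def IsSupportedOnHalfLineX (F : L2) : Prop :=
  ∃ a : ℝ, (∀ᵐ h : Heisenberg, h.x < a → F h = 0) ∨ (∀ᵐ h : Heisenberg, a < h.x → F h = 0)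

end Heisenberg

end

/-! Since `A` is injective and commutes with every `leftTranslation`, a relation among translates of
`A F` is one among translates of `F`, so it suffices to treat a nonzero `F` supported on a half-line
in `x`.

Suppose a nontrivial relation holds and `F` vanishes for `σ * x < a`. Among the group elements with
nonzero coefficient keep those minimizing `σ * x`. After a translation, the other terms vanish on
the slightly larger half-space `σ * x < a + ε`, where `ε` is bounded by the gap to the next
`x`-coordinate. There the relation involves only shifts in `y` combined with rotations of the
circle. Such shifts are independent (`ae_eq_zero_of_sum_vertical`): circle Fourier coefficients turn
rotations into unimodular scalars, and the Fourier transform in `y` turns shifts into multiplication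
by an exponential sum, nonzero almost everywhere. Hence `F` vanishes for `σ * x < a + ε`
(`ae_eq_zero_of_lt_add`). The same `ε` serves at every step, so iteration gives `F = 0`. -/

/-! ### Exponential sums and translates on the real line -/

/-- An exponential sum with distinct frequencies and not all coefficients zero vanishes only on a
null set. -/
theorem ae_ne_zero_exponential_sum {ι : Type*} (s : Finset ι) (c : ι → ℂ) (η : ι → ℝ)
    (hη : Set.InjOn η s) (hc : ∃ i ∈ s, c i ≠ 0) :
    ∀ᵐ v : ℝ, ∑ i ∈ s, c i * (Real.fourierChar (v * η i) : ℂ) ≠ 0 := by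
  have hne : ∃ v : ℝ, ∑ i ∈ s, c i * (Real.fourierChar (v * η i) : ℂ) ≠ 0 := by
    by_contra! h
    obtain ⟨i, hi, hci⟩ := hc
    let χ : ℝ → (Multiplicative ℝ →* ℂ) := fun r =>
      { toFun := fun v => (Real.fourierChar (v.toAdd * r) : ℂ)
        map_one' := by simp
        map_mul' := fun a b => by
          simp [add_mul, AddChar.map_add_eq_mul] }
    have hχ : Function.Injective χ := by
      intro a b hab
      by_contra hne
      have hd : b - a ≠ 0 := sub_ne_zero.2 (Ne.symm hne)
      -- At this point the two characters differ by the factor `exp (π i) = -1`.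
      have h1 := DFunLike.congr_fun hab (Multiplicative.ofAdd (1 / (2 * (b - a))))
      have h2 : (Real.fourierChar (1 / (2 * (b - a)) * a)) =
        (Real.fourierChar (1 / (2 * (b - a)) * b)) := Circle.ext h1
      have h3 : 1 / (2 * (b - a)) * b = 1 / (2 * (b - a)) * a + 1 / 2 := by
        field_simp; ring
      rw [h3, AddChar.map_add_eq_mul] at h2
      have h4 : Real.fourierChar (1 / 2 : ℝ) = 1 := by simpa using h2.symm
      have h5 := congrArg (fun z : Circle => (z : ℂ)) h4
      simp only [Real.fourierChar_apply] at h5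
      have : (((2 * Real.pi * (1 / 2 : ℝ) : ℝ) : ℂ) * Complex.I) = Real.pi * Complex.I := by
        push_cast; ring
      rw [this, Complex.exp_pi_mul_I] at h5
      norm_num at h5
    -- Dedekind's independence of characters, applied to the additive group written
    -- multiplicatively.
    have hli := linearIndependent_monoidHom (Multiplicative ℝ) ℂ
    have hli' := (hli.comp χ hχ)
    have hli2 : LinearIndepOn ℂ (fun j : ι => (χ (η j) : Multiplicative ℝ → ℂ)) (s : Set ι) := by
      have : Function.Injective (fun j : (s : Set ι) => η j) := fun a b hab =>
        Subtype.ext (hη a.2 b.2 hab)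
      exact hli'.comp (fun j : (s : Set ι) => η j) this
    refine hci ((linearIndepOn_finset_iff.1 hli2) c ?_ i hi)
    funext v
    simpa [χ] using h v.toAdd
  obtain ⟨v₀, hv₀⟩ := hne
  have han : AnalyticOnNhd ℝ
      (fun v : ℝ => ∑ i ∈ s, c i * (Real.fourierChar (v * η i) : ℂ)) Set.univ := by
    intro v _
    have : (fun v : ℝ => ∑ i ∈ s, c i * (Real.fourierChar (v * η i) : ℂ)) =
        fun v : ℝ => ∑ i ∈ s, c i * Complex.exp ((2 * Real.pi * η i * Complex.I) * (v : ℂ)) := by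
      funext v
      refine Finset.sum_congr rfl fun i _ => ?_
      rw [Real.fourierChar_apply]
      congr 2
      push_cast; ring
    rw [this]
    refine Finset.analyticAt_fun_sum _ fun i _ => ?_
    have h1 : AnalyticAt ℝ (fun v : ℝ => (2 * Real.pi * η i * Complex.I) * (v : ℂ)) v :=
      analyticAt_const.mul (Complex.ofRealCLM.analyticAt v)
    have h2 : AnalyticAt ℝ Complex.exp ((2 * Real.pi * η i * Complex.I) * (v : ℂ)) :=
      analyticAt_cexp.restrictScalars
    exact analyticAt_const.mul (AnalyticAt.fun_comp h2 h1)
  -- A real-analytic function that is nonzero at `v₀` has a discrete, hence null, zero set.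
  have hcod := han.preimage_zero_mem_codiscrete (x := v₀) hv₀
  have hle := ae_restrict_le_codiscreteWithin (μ := (volume : Measure ℝ)) MeasurableSet.univ
  rw [Measure.restrict_univ] at hle
  filter_upwards [hle hcod] with v hv
  simpa using hv

open FourierTransform in
/-- Translates of a nonzero function in `L²(ℝ)` are linearly independent. -/
theorem ae_eq_zero_of_sum_translates {ι : Type*} (s : Finset ι) (c : ι → ℂ) (η : ι → ℝ)
    (hη : Set.InjOn η s) (hc : ∃ i ∈ s, c i ≠ 0) (f : ℝ → ℂ) (hf : MemLp f 2)
    (h : ∀ᵐ y : ℝ, ∑ i ∈ s, c i * f (η i + y) = 0) : ∀ᵐ y : ℝ, f y = 0 := by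
  set u : Lp ℂ 2 (volume : Measure ℝ) := hf.toLp f with hu
  set p : ℝ → ℂ := fun v => ∑ i ∈ s, c i * (Real.fourierChar (v * η i) : ℂ) with hp
  have hpsm : ContDiff ℝ ⊤ p := by
    have : p = fun v : ℝ =>
        ∑ i ∈ s, c i * Complex.exp ((2 * Real.pi * η i * Complex.I) * (v : ℂ)) := by
      funext v
      refine Finset.sum_congr rfl fun i _ => ?_
      rw [Real.fourierChar_apply]
      congr 2
      push_cast; ring
    rw [this]
    refine ContDiff.sum fun i _ => contDiff_const.mul (ContDiff.cexp ?_)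
    exact contDiff_const.mul Complex.ofRealCLM.contDiff
  have hloc : LocallyIntegrable (fun v => p v * (𝓕 u : Lp ℂ 2 (volume : Measure ℝ)) v) volume := by
    have h1 : LocallyIntegrable (𝓕 u : Lp ℂ 2 (volume : Measure ℝ)) volume :=
      (Lp.memLp _).locallyIntegrable (by norm_num)
    simpa [smul_eq_mul, mul_comm] using h1.smul_continuous hpsm.continuous
  have hzero : ∀ᵐ v, p v * (𝓕 u : Lp ℂ 2 (volume : Measure ℝ)) v = 0 := by
    -- The `L²` Fourier transform is not given by an integral, so the product is tested against
    -- smooth compactly supported `g`. Duality moves the transform onto `p * g`, where the factor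
    -- `p` becomes a combination of shifts; these are then moved onto `f`.
    refine ae_eq_zero_of_integral_contDiff_smul_eq_zero hloc fun g hg hgs => ?_
    have hgs' : HasCompactSupport (fun v => (g v : ℂ)) :=
      hgs.comp_left (g := fun r : ℝ => (r : ℂ)) (by simp)
    have hg' : ContDiff ℝ (⊤ : ℕ∞) (fun v => (g v : ℂ)) := Complex.ofRealCLM.contDiff.comp hg
    let φ : SchwartzMap ℝ ℂ := hgs'.toSchwartzMap hg'
    let ψ : SchwartzMap ℝ ℂ := HasCompactSupport.toSchwartzMap (f := fun v => p v * (g v : ℂ))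
      hgs'.mul_left ((hpsm.of_le (by exact le_top)).mul hg')
    have hφ : ∀ v, φ v = (g v : ℂ) := fun v => rfl
    have hψ : ∀ v, ψ v = p v * (g v : ℂ) := fun v => rfl
    have key := DFunLike.congr_fun (Lp.fourier_toTemperedDistribution_eq u) ψ
    rw [TemperedDistribution.fourier_apply, Lp.toTemperedDistribution_apply,
      Lp.toTemperedDistribution_apply] at key
    have hL : ∫ v, g v • (p v * (𝓕 u : Lp ℂ 2 (volume : Measure ℝ)) v) =
        ∫ v, ψ v • (𝓕 u : Lp ℂ 2 (volume : Measure ℝ)) v := by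
      congr 1; funext v
      rw [hψ, Complex.real_smul, smul_eq_mul]; ring
    rw [hL, ← key]
    have hF : ∀ y, (𝓕 ψ) y = ∑ i ∈ s, c i * (𝓕 φ) (y - η i) := by
      intro y
      rw [SchwartzMap.fourier_coe, SchwartzMap.fourier_coe, Real.fourier_eq']
      simp only [Real.fourier_eq', hψ, hφ]
      simp_rw [← integral_const_mul]
      rw [← integral_finsetSum]
      · congr 1; funext v
        simp only [hp, smul_eq_mul, Finset.sum_mul, Finset.mul_sum]
        refine Finset.sum_congr rfl fun i _ => ?_
        have : Complex.exp (↑(-2 * Real.pi * inner ℝ v (y - η i)) * Complex.I) =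
          Complex.exp (↑(-2 * Real.pi * inner ℝ v y) * Complex.I) *
            (Real.fourierChar (v * η i) : ℂ) := by
          rw [Real.fourierChar_apply, ← Complex.exp_add]
          congr 1
          simp
          ring
        rw [this]; ring
      · intro i _
        refine Integrable.const_mul ?_ _
        have := (Real.fourierIntegral_convergent_iff (μ := volume) (f := φ) (y - η i)).2 φ.integrable
        refine this.congr ?_
        filter_upwards with v
        rw [Circle.smul_def, Real.fourierChar_apply, hφ]
        congr 3
        push_cast; ring
    have hint : ∀ i, Integrable (fun y => (𝓕 φ) (y - η i) * f y) := by
      intro i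
      have h1 : MemLp (fun y => (𝓕 φ) (y - η i)) 2 :=
        ((𝓕 φ).memLp 2 volume).comp_measurePreserving (measurePreserving_sub_right volume (η i))
      exact h1.integrable_mul hf
    have hcoe : ∀ᵐ y, u y = f y := hf.coeFn_toLp
    have hstep : ∫ y, (𝓕 ψ) y • u y = ∑ i ∈ s, c i * ∫ y, (𝓕 φ) (y - η i) * f y := by
      simp_rw [← integral_const_mul]
      rw [← integral_finsetSum _ fun i _ => (hint i).const_mul _]
      refine integral_congr_ae ?_
      filter_upwards [hcoe] with y hy
      rw [hy, hF, smul_eq_mul, Finset.sum_mul]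
      exact Finset.sum_congr rfl fun i _ => by ring
    rw [hstep]
    have hshift : ∀ i, ∫ y, (𝓕 φ) (y - η i) * f y = ∫ y, (𝓕 φ) y * f (η i + y) := by
      intro i
      rw [← integral_add_left_eq_self _ (η i)]
      simp
    simp_rw [hshift, ← integral_const_mul]
    rw [← integral_finsetSum]
    · rw [← integral_zero ℝ ℂ]
      refine integral_congr_ae ?_
      filter_upwards [h] with y hy
      calc _ = (𝓕 φ) y * ∑ i ∈ s, c i * f (η i + y) := by
            rw [Finset.mul_sum]; exact Finset.sum_congr rfl fun i _ => by ring
        _ = 0 := by rw [hy, mul_zero]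
    · intro i _
      refine Integrable.const_mul ?_ _
      exact ((𝓕 φ).memLp 2 volume).integrable_mul
        (hf.comp_measurePreserving (measurePreserving_add_left volume (η i)))
  have hu0 : 𝓕 u = 0 := by
    rw [Lp.eq_zero_iff_ae_eq_zero]
    filter_upwards [hzero, ae_ne_zero_exponential_sum s c η hη hc] with v h1 h2
    exact (mul_eq_zero.1 h1).resolve_left h2
  have hu00 : u = 0 := by
    have := congrArg norm hu0
    rwa [Lp.norm_fourier_eq, norm_zero, norm_eq_zero] at this
  filter_upwards [hf.coeFn_toLp, (Lp.eq_zero_iff_ae_eq_zero).1 hu00] with y h1 h2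
  rw [← h1]; exact h2

/-! ### Fourier uniqueness on the circle -/

namespace Heisenberg

/-- The pushforward is an invariant probability measure, so uniqueness of Haar measure applies. This
gives access to the Fourier basis of `AddCircle`. -/
theorem measurePreserving_toCircle :
    MeasurePreserving (AddCircle.toCircle : AddCircle (1 : ℝ) → Circle)
      AddCircle.haarAddCircle circleMeasure := by
  have hm : Measurable (AddCircle.toCircle : AddCircle (1 : ℝ) → Circle) :=
    AddCircle.continuous_toCircle.measurable
  refine ⟨hm, ?_⟩
  set μ := Measure.map (AddCircle.toCircle : AddCircle (1 : ℝ) → Circle) AddCircle.haarAddCircle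
  have : IsProbabilityMeasure μ := Measure.isProbabilityMeasure_map hm.aemeasurable
  have : μ.IsMulLeftInvariant := by
    refine ⟨fun w => ?_⟩
    obtain ⟨t, rfl⟩ := (AddCircle.homeomorphCircle (T := 1) one_ne_zero).surjective w
    rw [AddCircle.homeomorphCircle_apply, Measure.map_map (measurable_const_mul _) hm]
    have : (fun x => AddCircle.toCircle t * x) ∘ (AddCircle.toCircle : AddCircle (1 : ℝ) → Circle) =
        AddCircle.toCircle ∘ fun x => t + x := by
      funext x; simp [AddCircle.toCircle_add]
    rw [this, ← Measure.map_map hm (measurable_const_add t), map_add_left_eq_self]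
  have := Measure.haarMeasure_unique μ (⊤ : TopologicalSpace.PositiveCompacts Circle)
  rw [this]
  simp [circleMeasure]

/-- A square-integrable function on the circle with vanishing Fourier coefficients is zero. -/
theorem ae_eq_zero_of_circle_coeff (g : Circle → ℂ) (hg : MemLp g 2 circleMeasure)
    (h : ∀ n : ℤ, ∫ w, ((w ^ n : Circle) : ℂ) * g w ∂circleMeasure = 0) :
    ∀ᵐ w ∂circleMeasure, g w = 0 := by
  have hmp := measurePreserving_toCircle
  have hemb : MeasurableEmbedding (AddCircle.toCircle : AddCircle (1 : ℝ) → Circle) := by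
    have := (AddCircle.homeomorphCircle (T := 1) one_ne_zero).measurableEmbedding
    convert! this using 1
    funext x; rw [AddCircle.homeomorphCircle_apply]
  have hG := hg.comp_measurePreserving hmp
  have hz : hG.toLp _ = 0 := by
    apply fourierBasis.repr.injective
    ext n
    rw [fourierBasis_repr, map_zero]
    rw [fourierCoeff_congr_ae hG.coeFn_toLp, fourierCoeff]
    -- `fourierCoeff` pairs with the character of index `-n`.
    have := h (-n)
    rw [← hmp.integral_comp hemb] at this
    simpa [fourier_apply, AddCircle.toCircle_zsmul, ← Circle.coe_inv_eq_conj] using this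
  have h0 : ∀ᵐ t ∂AddCircle.haarAddCircle, g (AddCircle.toCircle (T := 1) t) = 0 := by
    filter_upwards [hG.coeFn_toLp, (Lp.eq_zero_iff_ae_eq_zero).1 hz] with y h1 h2
    rw [← Function.comp_apply (f := g), ← h1]; exact h2
  rw [← hmp.map_eq]
  exact hemb.ae_map_iff.2 h0

end Heisenberg

/-! ### Sections of functions on a product -/

section Fubini

variable {α β : Type*} [MeasurableSpace α] [MeasurableSpace β] {μ : Measure α} {ν : Measure β}
  [SFinite μ] [SFinite ν]

/-- Almost every section of a square-integrable function is square-integrable. -/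
theorem MeasureTheory.MemLp.ae_memLp_section {f : α × β → ℂ} (hf : MemLp f 2 (μ.prod ν)) :
    ∀ᵐ y ∂ν, MemLp (fun x => f (x, y)) 2 μ := by
  have h1 := ((memLp_two_iff_integrable_sq_norm hf.1).1 hf).prod_left_ae
  have h2 : ∀ᵐ y ∂ν, AEStronglyMeasurable (fun x => f (x, y)) μ := hf.1.prod_swap.prodMk_left
  filter_upwards [h1, h2] with y hy1 hy2
  exact (memLp_two_iff_integrable_sq_norm hy2).2 hy1

theorem MeasureTheory.ae_ae_of_ae_prod_left {p : α × β → Prop} (h : ∀ᵐ z ∂μ.prod ν, p z) :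
    ∀ᵐ y ∂ν, ∀ᵐ x ∂μ, p (x, y) :=
  Measure.ae_ae_of_ae_prod (Measure.measurePreserving_swap.quasiMeasurePreserving.ae h)

/-- A function almost all of whose sections vanish is zero almost everywhere. -/
theorem MeasureTheory.AEStronglyMeasurable.ae_eq_zero_of_ae_section {f : α × β → ℂ}
    (hf : AEStronglyMeasurable f (μ.prod ν)) (h : ∀ᵐ y ∂ν, ∀ᵐ x ∂μ, f (x, y) = 0) :
    ∀ᵐ z ∂μ.prod ν, f z = 0 := by
  -- Exchanging the two almost-everywhere quantifiers needs a measurable set, hence the passage to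
  -- `hf.mk f`.
  have hms : MeasurableSet {z : α × β | hf.mk f z = 0} :=
    hf.stronglyMeasurable_mk.measurable (measurableSet_singleton 0)
  have h1 : ∀ᵐ y ∂ν, ∀ᵐ x ∂μ, hf.mk f (x, y) = 0 := by
    filter_upwards [h, ae_ae_of_ae_prod_left hf.ae_eq_mk] with y hy1 hy2
    filter_upwards [hy1, hy2] with x hx1 hx2
    rw [← hx2, hx1]
  have h2 : ∀ᵐ z ∂μ.prod ν, hf.mk f z = 0 :=
    (Measure.ae_prod_iff_ae_ae hms).2
      ((Measure.ae_ae_comm (p := fun x y => hf.mk f (x, y) = 0) hms).2 h1)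
  filter_upwards [h2, hf.ae_eq_mk] with z hz1 hz2
  rw [hz2, hz1]

end Fubini

/-! ### Circle coefficients and vertical translates -/

namespace Heisenberg

theorem continuous_coe_zpow (n : ℤ) : Continuous fun w : Circle => ((w ^ n : Circle) : ℂ) :=
  continuous_subtype_val.comp (continuous_zpow n)

/-- The `n`-th Fourier coefficient in the circle variable. -/
noncomputable def circleCoeff (n : ℤ) (G : Circle × (ℝ × ℝ) → ℂ) (q : ℝ × ℝ) : ℂ :=
  ∫ w, ((w ^ n : Circle) : ℂ) * G (w, q) ∂circleMeasure

/-- Jensen's inequality on the probability space `circleMeasure` bounds the squared coefficient by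
the fibre integral of `‖G‖ ^ 2`. -/
theorem memLp_circleCoeff (n : ℤ) {G : Circle × (ℝ × ℝ) → ℂ}
    (hG : MemLp G 2 (circleMeasure.prod volume)) : MemLp (circleCoeff n G) 2 := by
  have hmeas : AEStronglyMeasurable (circleCoeff n G) volume := by
    have h1 : AEStronglyMeasurable
        (fun p : Circle × (ℝ × ℝ) => ((p.1 ^ n : Circle) : ℂ) * G p) (circleMeasure.prod volume) :=
      ((continuous_coe_zpow n).comp continuous_fst).aestronglyMeasurable.mul hG.1
    exact h1.prod_swap.integral_prod_right'
  rw [memLp_two_iff_integrable_sq_norm hmeas]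
  have hsq := (memLp_two_iff_integrable_sq_norm hG.1).1 hG
  refine hsq.integral_prod_right.mono' (hmeas.norm.pow 2) ?_
  filter_upwards [hG.ae_memLp_section] with q hq
  rw [Real.norm_of_nonneg (by positivity)]
  have h1 : ‖circleCoeff n G q‖ ≤ ∫ w, ‖G (w, q)‖ ∂circleMeasure := by
    refine (norm_integral_le_integral_norm _).trans_eq ?_
    simp_rw [norm_mul, Circle.norm_coe, one_mul]
  have hi : Integrable (fun w => ‖G (w, q)‖) circleMeasure :=
    (hq.integrable (by norm_num)).norm
  have hi2 : Integrable (fun w => ‖G (w, q)‖ ^ 2) circleMeasure :=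
    (memLp_two_iff_integrable_sq_norm hq.1).1 hq
  calc ‖circleCoeff n G q‖ ^ 2 ≤ (∫ w, ‖G (w, q)‖ ∂circleMeasure) ^ 2 := by gcongr
    _ ≤ ∫ w, ‖G (w, q)‖ ^ 2 ∂circleMeasure :=
      (even_two.convexOn_pow (𝕜 := ℝ)).map_integral_le (continuous_pow 2).continuousOn
        isClosed_univ (by simp) hi hi2

theorem circleCoeff_mul_left (n : ℤ) (G : Circle × (ℝ × ℝ) → ℂ) (ζ : Circle) (q : ℝ × ℝ) :
    ∫ w, ((w ^ n : Circle) : ℂ) * G (ζ * w, q) ∂circleMeasure =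
      (((ζ⁻¹) ^ n : Circle) : ℂ) * circleCoeff n G q := by
  rw [circleCoeff, ← integral_const_mul,
    ← integral_mul_left_eq_self (μ := circleMeasure) (fun w => _ * (_ * G (w, q))) ζ]
  congr 1; funext w
  rw [← mul_assoc, ← Circle.coe_mul, ← mul_zpow, inv_mul_cancel_left]

/-- Vertical translates, up to a rotation of the circle, of a nonzero square-integrable function
are linearly independent. -/
theorem ae_eq_zero_of_sum_vertical {ι : Type*} (s : Finset ι) (c : ι → ℂ) (ζ : ι → Circle)
    (η : ι → ℝ) (hη : Set.InjOn η s) (hc : ∃ i ∈ s, c i ≠ 0) {G : Circle × (ℝ × ℝ) → ℂ}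
    (hG : MemLp G 2 (circleMeasure.prod volume))
    (h : ∀ᵐ p : Circle × (ℝ × ℝ) ∂circleMeasure.prod volume,
      ∑ i ∈ s, c i * G (ζ i * p.1, (η i + p.2.1, p.2.2)) = 0) :
    ∀ᵐ p ∂circleMeasure.prod volume, G p = 0 := by
  have hcoeff : ∀ n : ℤ, ∀ᵐ q, circleCoeff n G q = 0 := by
    intro n
    have hrel : ∀ᵐ q : ℝ × ℝ, ∑ i ∈ s, (c i * (((ζ i)⁻¹ ^ n : Circle) : ℂ)) *
        circleCoeff n G (η i + q.1, q.2) = 0 := by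
      have hsec : ∀ᵐ q : ℝ × ℝ, ∀ i ∈ s,
          MemLp (fun w => G (ζ i * w, (η i + q.1, q.2))) 2 circleMeasure := by
        rw [Filter.eventually_all_finset]
        intro i _
        have hmp : MeasurePreserving (fun q : ℝ × ℝ => (η i + q.1, q.2)) volume volume :=
          (measurePreserving_add_left volume (η i)).prod (MeasurePreserving.id volume)
        filter_upwards [hmp.quasiMeasurePreserving.ae hG.ae_memLp_section] with q hq
        exact hq.comp_measurePreserving (MeasureTheory.measurePreserving_mul_left circleMeasure (ζ i))
      filter_upwards [hsec, ae_ae_of_ae_prod_left h] with q hq1 hq2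
      simp_rw [mul_assoc, ← circleCoeff_mul_left, ← integral_const_mul]
      rw [← integral_finsetSum, ← integral_zero Circle ℂ (μ := circleMeasure)]
      · refine integral_congr_ae ?_
        filter_upwards [hq2] with w hw
        calc _ = ((w ^ n : Circle) : ℂ) * ∑ i ∈ s, c i * G (ζ i * w, (η i + q.1, q.2)) := by
              rw [Finset.mul_sum]; exact Finset.sum_congr rfl fun i _ => by ring
          _ = 0 := by rw [hw, mul_zero]
      · intro i hi
        refine Integrable.const_mul ?_ _
        refine ((hq1 i hi).integrable (by norm_num)).bdd_mul (c := 1) ?_ ?_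
        · exact (continuous_coe_zpow n).aestronglyMeasurable
        · exact Filter.Eventually.of_forall fun w => (Circle.norm_coe _).le
    have hmem := memLp_circleCoeff n hG
    rw [Measure.volume_eq_prod] at hrel hmem ⊢
    -- The shifts leave `x` fixed, so the one-dimensional result applies on almost every line of
    -- constant `x`.
    refine hmem.1.ae_eq_zero_of_ae_section ?_
    filter_upwards [ae_ae_of_ae_prod_left hrel, hmem.ae_memLp_section] with x hx1 hx2
    refine ae_eq_zero_of_sum_translates s _ η hη ?_ _ hx2 hx1
    obtain ⟨i, hi, hci⟩ := hc
    exact ⟨i, hi, mul_ne_zero hci (Circle.coe_ne_zero _)⟩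
  refine hG.1.ae_eq_zero_of_ae_section ?_
  filter_upwards [hG.ae_memLp_section, ae_all_iff.2 hcoeff] with q hq1 hq2
  exact ae_eq_zero_of_circle_coeff _ hq1 hq2

end Heisenberg

/-! ### Propagation of vanishing across half-spaces -/

namespace Heisenberg

/-- If finitely many left translates of `F` by elements of distinct cosets of the centre satisfy a
linear relation, and `x₀` is the first occurring `x`-coordinate, then vanishing of `F` on the
half-space `σ x < a` propagates to `σ x < a + ε`, where `ε` separates `x₀` from the later
`x`-coordinates. -/
theorem ae_eq_zero_of_lt_add (σ ε a x₀ : ℝ) (S : Finset Heisenberg) (c : Heisenberg → ℂ)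
    {F : Heisenberg → ℂ} (hF : MemLp F 2)
    (hinj : ∀ k ∈ S, ∀ l ∈ S, k.x = l.x → k.y = l.y → k = l)
    (hgap : ∀ k ∈ S, k.x ≠ x₀ → σ * x₀ + ε ≤ σ * k.x) (hne : ∃ k ∈ S, k.x = x₀ ∧ c k ≠ 0)
    (hrel : ∀ᵐ h, ∑ k ∈ S, c k * F (k⁻¹ * h) = 0) (hsupp : ∀ᵐ h : Heisenberg, σ * h.x < a → F h = 0) :
    ∀ᵐ h : Heisenberg, σ * h.x < a + ε → F h = 0 := by
  classical
  -- For `k.x = x₀`, the element `k⁻¹ * t` has `x`-coordinate `0`, so it acts vertically.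
  set t : Heisenberg := ⟨1, 0, x₀⟩ with ht
  have hset : MeasurableSet {p : Circle × (ℝ × ℝ) | σ * p.2.2 < a + ε} :=
    measurableSet_lt (by fun_prop) measurable_const
  -- Vertical shifts preserve the cut-off region, so truncating `F` there keeps the relation and
  -- stays in `L²`.
  set G : Circle × (ℝ × ℝ) → ℂ :=
    {p : Circle × (ℝ × ℝ) | σ * p.2.2 < a + ε}.indicator (F ∘ equivProd.symm) with hGdef
  have hG : MemLp G 2 (circleMeasure.prod volume) :=
    (hF.comp_measurePreserving measurePreserving_equivProd_symm).indicator hset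
  have hG0 : ∀ᵐ p ∂circleMeasure.prod volume, G p = 0 := by
    refine ae_eq_zero_of_sum_vertical (S.filter fun k => k.x = x₀) c (fun k => (k⁻¹ * t).z)
      (fun k => -k.y) ?_ ?_ hG ?_
    · intro k hk l hl hkl
      simp only [Finset.coe_filter, Set.mem_ofPred_eq] at hk hl
      exact hinj k hk.1 l hl.1 (hk.2.trans hl.2.symm) (neg_injective hkl)
    · obtain ⟨k, hk, hkx, hck⟩ := hne
      exact ⟨k, Finset.mem_filter.2 ⟨hk, hkx⟩, hck⟩
    · have h1 : ∀ᵐ h : Heisenberg, ∑ k ∈ S, c k * F (k⁻¹ * (t * h)) = 0 :=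
        (measurePreserving_mul_left t).quasiMeasurePreserving.ae hrel
      have h2 : ∀ᵐ h : Heisenberg, ∀ k ∈ S,
          σ * (k⁻¹ * (t * h)).x < a → F (k⁻¹ * (t * h)) = 0 := by
        rw [Filter.eventually_all_finset]
        intro k _
        exact (measurePreserving_mul_left t).quasiMeasurePreserving.ae
          ((measurePreserving_mul_left k⁻¹).quasiMeasurePreserving.ae hsupp)
      filter_upwards [measurePreserving_equivProd_symm.quasiMeasurePreserving.ae h1,
        measurePreserving_equivProd_symm.quasiMeasurePreserving.ae h2] with p hp1 hp2
      have hx : ∀ k : Heisenberg, (k⁻¹ * (t * equivProd.symm p)).x = -k.x + (x₀ + p.2.2) :=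
        fun k => rfl
      have hmove : ∀ k : Heisenberg, k.x = x₀ → equivProd.symm ((k⁻¹ * t).z * p.1,
          (-k.y + p.2.1, p.2.2)) = k⁻¹ * (t * equivProd.symm p) := by
        intro k hk
        rw [← mul_assoc]
        ext1 <;> simp [equivProd, mul_def, inv_def, ht, hk]
      by_cases hp : σ * p.2.2 < a + ε
      · rw [← hp1, Finset.sum_filter]
        refine Finset.sum_congr rfl fun k hk => ?_
        split_ifs with hkx
        · rw [hGdef, Set.indicator_of_mem (by exact hp), Function.comp_apply, hmove k hkx]
        · rw [hp2 k hk, mul_zero]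
          rw [hx]
          have := hgap k hk hkx
          nlinarith
      · refine Finset.sum_eq_zero fun k _ => ?_
        rw [hGdef, Set.indicator_of_notMem (by exact hp), mul_zero]
  filter_upwards [measurePreserving_equivProd.quasiMeasurePreserving.ae hG0] with h hh hlt
  rw [hGdef, Set.indicator_of_mem (by exact hlt)] at hh
  simpa using hh

/-- A function on the Heisenberg group that vanishes on a half-space `σ x < a` and satisfies a
nontrivial linear relation between its left translates is zero. -/
theorem ae_eq_zero_of_sum_leftTranslates {σ : ℝ} (hσ : σ ≠ 0) (a : ℝ) (S : Finset Heisenberg)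
    (c : Heisenberg → ℂ) {F : Heisenberg → ℂ} (hF : MemLp F 2)
    (hinj : ∀ k ∈ S, ∀ l ∈ S, k.x = l.x → k.y = l.y → k = l)
    (hne : S.Nonempty) (hc : ∀ k ∈ S, c k ≠ 0)
    (hrel : ∀ᵐ h, ∑ k ∈ S, c k * F (k⁻¹ * h) = 0) (hsupp : ∀ᵐ h : Heisenberg, σ * h.x < a → F h = 0) :
    ∀ᵐ h, F h = 0 := by
  obtain ⟨k₀, hk₀, hmin⟩ := S.exists_min_image (fun k => σ * k.x) hne
  obtain ⟨ε, hgap, hε⟩ : ∃ ε : ℝ, (∀ k ∈ S, k.x ≠ k₀.x → σ * k₀.x + ε ≤ σ * k.x) ∧ 0 < ε := by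
    -- Only finitely many positive gaps occur, so every small `ε > 0` works.
    have hev : ∀ᶠ ε in nhdsWithin (0 : ℝ) (Set.Ioi 0),
        ∀ k ∈ S, k.x ≠ k₀.x → σ * k₀.x + ε ≤ σ * k.x := by
      rw [Filter.eventually_all_finset]
      intro k hk
      by_cases hkx : k.x = k₀.x
      · exact Filter.Eventually.of_forall fun _ h => (h hkx).elim
      · have hlt : 0 < σ * k.x - σ * k₀.x :=
          sub_pos.2 (lt_of_le_of_ne (hmin k hk) fun h => hkx (mul_left_cancel₀ hσ h).symm)
        filter_upwards [Ioc_mem_nhdsGT hlt] with ε hε _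
        linarith [hε.2]
    exact (hev.and self_mem_nhdsWithin).exists
  have hall : ∀ n : ℕ, ∀ᵐ h : Heisenberg, σ * h.x < a + n * ε → F h = 0 := by
    intro n
    induction n with
    | zero => simpa using hsupp
    | succ n ih =>
      have := ae_eq_zero_of_lt_add σ ε (a + n * ε) k₀.x S c hF hinj hgap
        ⟨k₀, hk₀, rfl, hc k₀ hk₀⟩ hrel ih
      filter_upwards [this] with h hh hlt
      refine hh ?_
      push_cast at hlt
      linarith
  filter_upwards [ae_all_iff.2 hall] with h hh
  obtain ⟨n, hn⟩ := exists_nat_gt ((σ * h.x - a) / ε)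
  rw [div_lt_iff₀ hε] at hn
  exact hh n (by linarith)

/-! ### Linear independence in `L²(ℍ)` -/

theorem leftTranslation_ae (k : Heisenberg) (F : L2) :
    ∀ᵐ h, leftTranslation k F h = F (k⁻¹ * h) :=
  Lp.coeFn_compMeasurePreserving F (measurePreserving_mul_left k⁻¹)

theorem sum_leftTranslation_ae (S : Finset Heisenberg) (c : Heisenberg → ℂ) (F : L2) :
    ∀ᵐ h, (∑ k ∈ S, c k • leftTranslation k F : L2) h = ∑ k ∈ S, c k * F (k⁻¹ * h) := by
  have h1 : ∀ᵐ h, ∀ k ∈ S, leftTranslation k F h = F (k⁻¹ * h) :=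
    (Filter.eventually_all_finset S).2 fun k _ => leftTranslation_ae k F
  have h2 : ∀ᵐ h, ∀ k ∈ S, (c k • leftTranslation k F : L2) h = c k * leftTranslation k F h :=
    (Filter.eventually_all_finset S).2 fun k _ => Lp.coeFn_smul (c k) (leftTranslation k F)
  filter_upwards [h1, h2, Lp.coeFn_finsetSum S fun k => c k • leftTranslation k F] with h h1 h2 h3
  rw [h3, Finset.sum_apply]
  exact Finset.sum_congr rfl fun k hk => by rw [h2 k hk, h1 k hk]

/-- The Heisenberg-Translate conjecture holds for nonzero square-integrable functions supported on
a half-line in the `x`-variable. -/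
theorem IsSupportedOnHalfLineX.translatesIndependent {F : L2} (hF : IsSupportedOnHalfLineX F)
    (hF0 : F ≠ 0) : TranslatesIndependent F := by
  classical
  intro S hS
  -- The sign `σ = ±1` treats both half-lines at once.
  have hsupp : ∃ σ : ℝ, σ ≠ 0 ∧ ∃ a : ℝ, ∀ᵐ h : Heisenberg, σ * h.x < a → F h = 0 := by
    obtain ⟨a, ha | ha⟩ := hF
    · exact ⟨1, one_ne_zero, a, by simpa using ha⟩
    · refine ⟨-1, by norm_num, -a, ?_⟩
      simpa using ha
  obtain ⟨σ, hσ, a, hsupp⟩ := hsupp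
  have hinj : ∀ k ∈ S, ∀ l ∈ S, k.x = l.x → k.y = l.y → k = l := by
    intro k hk l hl hx hy
    refine hS hk hl (QuotientGroup.eq.2 ?_)
    change (k⁻¹ * l).y = 0 ∧ (k⁻¹ * l).x = 0
    simp [mul_def, inv_def, hx, hy]
  change LinearIndepOn ℂ (fun h => leftTranslation h F) (S : Set Heisenberg)
  rw [linearIndepOn_finset_iff]
  intro c hc
  by_contra! hne
  have hrel : ∀ᵐ h, ∑ k ∈ S, c k * F (k⁻¹ * h) = 0 := by
    filter_upwards [sum_leftTranslation_ae S c F, Lp.eq_zero_iff_ae_eq_zero.1 hc] with h h1 h2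
    rw [← h1, h2, Pi.zero_apply]
  refine hF0 ((Lp.eq_zero_iff_ae_eq_zero).2 ?_)
  -- Zero coefficients are discarded so that the extremal `x`-coordinate really occurs in the
  -- relation.
  refine ae_eq_zero_of_sum_leftTranslates hσ a (S.filter fun k => c k ≠ 0) c (Lp.memLp F)
    (fun k hk l hl => hinj k (Finset.filter_subset _ _ hk) l (Finset.filter_subset _ _ hl)) ?_ ?_
    ?_ hsupp
  · obtain ⟨k, hk, hck⟩ := hne
    exact ⟨k, Finset.mem_filter.2 ⟨hk, hck⟩⟩
  · exact fun k hk => (Finset.mem_filter.1 hk).2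
  · filter_upwards [hrel] with h hh
    rw [Finset.sum_filter_of_ne fun k _ hk => left_ne_zero_of_mul hk]
    exact hh

end Heisenberg

theorem proposition3p5 (A : Heisenberg.L2 →L[ℂ] Heisenberg.L2)
    (hA : A ∈ Heisenberg.leftCommutant) (hA_inv : IsUnit A)
    (F : Heisenberg.L2) (hF_schwartz : Heisenberg.IsSchwartzYX F)
    (hF_half : Heisenberg.IsSupportedOnHalfLineX F) (hAF : A F ≠ 0) :
    Heisenberg.TranslatesIndependent (A F) := by
  have hF0 : F ≠ 0 := by
    rintro rfl
    exact hAF (map_zero A)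
  have hker : LinearMap.ker (A : Heisenberg.L2 →ₗ[ℂ] Heisenberg.L2) = ⊥ := by
    obtain ⟨B, hB⟩ := hA_inv.exists_left_inv
    rw [LinearMap.ker_eq_bot]
    exact Function.LeftInverse.injective (g := B) fun v => DFunLike.congr_fun hB v
  intro S hS
  have hcomm : (fun h : S => Heisenberg.leftTranslation (h : Heisenberg) (A F)) =
      A ∘ fun h : S => Heisenberg.leftTranslation (h : Heisenberg) F :=
    funext fun h => (DFunLike.congr_fun (hA (h : Heisenberg)) F).symm
  rw [hcomm]
  exact (hF_half.translatesIndependent hF0 S hS).map' _ hker
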